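/- Let $\Theta$ be a non-empty set of atomic propositions and $N$ a finite set of agents. Consider the language $\phi ::= p \mid \neg\phi \mid \phi\wedge\phi \mid [G]\phi \mid K_i\phi \mid C_H\phi$ ($p\in\Theta$, $i\in N$, $G\subseteq N$, $\emptyset\neq H\subseteq N$), with the usual derived connectives and $E_G\phi := \bigwedge_{i\in G}K_i\phi$. The system $CLC$ has as axioms all instances of propositional tautologies and of (G1) $\neg[G]\bot$; (G2) $[G]\top$; (G3) $\neg[\emptyset]\neg\phi\to[N]\phi$; (G4) $[G](\phi\wedge\psi)\to[G]\psi$; (G5) $[G_1]\phi\wedge[G_2]\psi\to[G_1\cup G_2](\phi\wedge\psi)$ if $G_1\cap G_2=\emptyset$; (K) $K_i(\phi\to\psi)\to(K_i\phi\to K_i\psi)$; (T) $K_i\phi\to\phi$; (4) $K_i\phi\to K_iK_i\phi$; (5) $\neg K_i\phi\to K_i\neg K_i\phi$; (C1) $E_G\phi\leftrightarrow\bigwedge_{i\in G}K_i\phi$; (C2) $C_G\phi\to E_G(\phi\wedge C_G\phi)$. Its rules are modus ponens; from $\phi\leftrightarrow\psi$ infer $[G]\phi\leftrightarrow[G]\psi$;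 from $\phi$ infer $K_i\phi$; from $\phi\to E_G(\phi\wedge\psi)$ infer $\phi\to C_G\psi$. A formula is $CLC$-consistent if its negation is not provable; a set of formulas is $CLC$-consistent if all conjunctions of finitely many of its members are. An epistemic coalition model is $M=\langle S,E,(\sim_i)_{i\in N},V\rangle$ with $S\neq\emptyset$, $V(s)\subseteq\Theta$, each $\sim_i$ an equivalence relation on $S$, and, for each $s\in S$, a map $E(s)$ sending each $G\subseteq N$ to a set $E(s)(G)\subseteq 2^S$ such that (E1) $\emptyset\notin E(s)(G)$; (E2) $S\in E(s)(G)$; (E3) $S\setminus X\notin E(s)(\emptyset)$ implies $X\in E(s)(N)$; (E4) $X\in E(s)(G)$ and $X\subseteq Y$ imply $Y\in E(s)(G)$; (E5) $X\in E(s)(G_1)$, $Y\in E(s)(G_2)$ and $G_1\cap G_2=\emptyset$ imply $X\cap Y\in E(s)(G_1\cup G_2)$; (E6) $E(s)(\emptyset)$ has an element that is minimal for inclusion. A playable model is defined in the same way, but without (E6). Truth is defined as usual, with $M,s\models[G]\phi$ iff $\{t: M,t\models\phi\}\in E(s)(G)$, $M,s\models K_i\phi$ iff $M,t\models\phi$ whenever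 $s\sim_i t$, and $M,s\models C_G\phi$ iff $M,t\models\phi$ whenever $(s,t)$ is in the transitive closure of $\bigcup_{i\in G}\sim_i$. The canonical structure $M^c$ has as states $S^c$ the maximal $CLC$-consistent sets of formulas; $s\sim^c_i t$ iff $\{\psi:K_i\psi\in s\}=\{\psi:K_i\psi\in t\}$; $V^c(s)=\{p : p\in s\}$; and, with $\hat\psi=\{s\in S^c:\psi\in s\}$, $X\in E^c(s)(G)$ iff $[G]\psi\in s$ for some $\psi$ with $\hat\psi\subseteq X$ (if $G\ne N$), and $X\in E^c(s)(N)$ iff $[\emptyset]\psi\notin s$ for all $\psi$ with $\hat\psi\subseteq S^c\setminus X$. For a formula $\phi$ let $cl(\phi)$ be the least set containing all subformulas of $\phi$ such that $\neg\psi\in cl(\phi)$ whenever $\psi\in cl(\phi)$ is not a negation, and $K_iC_G\psi\in cl(\phi)$ whenever $C_G\psi\in cl(\phi)$ and $i\in G$ (this set is finite). Put $[s]=s\cap cl(\phi)$ for $s\in S^c$, let $\phi_{[s]}$ be the conjunction of the formulas in $[s]$, and $\phi_X=\bigvee_{[t]\in X}\phi_{[t]}$ for a set $X$ of such classes. Fix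 a choice $r$ of a representative $r(x)\in S^c$ with $[r(x)]=x$ for each class $x$. The filtration $M^f$ has states $S^f=\{[s]:s\in S^c\}$; $x\sim^f_i y$ iff $\{\psi:K_i\psi\in x\}=\{\psi:K_i\psi\in y\}$; $p$ is true at $x$ iff $x=[s]$ for some $s\in S^c$ with $p\in s$; and $X\in E^f(x)(G)$ iff $\{s':\phi_X\in s'\}\in E^c(r(x))(G)$. **Theorem.** Let $\phi$ be a $CLC$-consistent formula. Then $\phi$ is satisfied at some state of some epistemic coalition model. Moreover, if $N\neq\emptyset$ then $M^c$ is a playable model; and, whether or not $N$ is empty, for every choice $r$ of representatives $M^f$ is finite, its relations $\sim^f_i$ are equivalence relations, each $E^f(x)$ satisfies E1–E5 and also E6 (so $M^f$ is an epistemic coalition model), and $\phi$ is satisfied at some state of $M^f$. -/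

import Mathlib

universe u v w

namespace CLC

/-- Formulas of coalition logic with individual and common knowledge, over a set `N` of agents and
a set `Θ` of atomic propositions: `p`, `¬φ`, `φ ∧ ψ`, `[G]φ`, `K_i φ`, and `C_G φ` for `G ≠ ∅`. -/
inductive Formula (N : Type u) (Θ : Type v) : Type (max u v)
  | atom (p : Θ) : Formula N Θ
  | neg (φ : Formula N Θ) : Formula N Θ
  | conj (φ ψ : Formula N Θ) : Formula N Θ
  | coal (G : Finset N) (φ : Formula N Θ) : Formula N Θ
  | know (i : N) (φ : Formula N Θ) : Formula N Θ
  | common (G : Finset N) (hG : G.Nonempty) (φ : Formula N Θ) : Formula N Θ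

namespace Formula

variable {N : Type u} {Θ : Type v}

/-! Derived connectives. Every formula contains an atom, so `Nonempty Θ` (needed to write down a
contradiction) excludes no formula. -/

/-- `φ → ψ`, as `¬(φ ∧ ¬ψ)`. -/
def imp (φ ψ : Formula N Θ) : Formula N Θ := neg (conj φ (neg ψ))

/-- `φ ∨ ψ`, as `¬(¬φ ∧ ¬ψ)`. -/
def disj (φ ψ : Formula N Θ) : Formula N Θ := neg (conj (neg φ) (neg ψ))

/-- `φ ↔ ψ`. -/
def iff (φ ψ : Formula N Θ) : Formula N Θ := conj (imp φ ψ) (imp ψ φ)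

/-- `⊥`, as `p ∧ ¬p` for a fixed atom `p`. -/
noncomputable def bot [Nonempty Θ] : Formula N Θ :=
  conj (atom (Classical.arbitrary Θ)) (neg (atom (Classical.arbitrary Θ)))

/-- `⊤`, as `¬⊥`. -/
noncomputable def top [Nonempty Θ] : Formula N Θ := neg bot

/-- Finite conjunction (the empty one is `⊤`). -/
noncomputable def bigAnd [Nonempty Θ] (l : List (Formula N Θ)) : Formula N Θ := l.foldr conj top

/-- Finite disjunction (the empty one is `⊥`). -/
noncomputable def bigOr [Nonempty Θ] (l : List (Formula N Θ)) : Formula N Θ := l.foldr disj bot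

/-- `E_G φ`, the conjunction of the `K_i φ` for `i ∈ G`. -/
noncomputable def everyone [Nonempty Θ] (G : Finset N) (φ : Formula N Θ) : Formula N Θ :=
  bigAnd (G.toList.map fun i => know i φ)

/-- Evaluation of a formula under an assignment `v` of truth values to the formulas that are not
negations or conjunctions. -/
def propEval (v : Formula N Θ → Prop) : Formula N Θ → Prop
  | neg φ => ¬ propEval v φ
  | conj φ ψ => propEval v φ ∧ propEval v ψ
  | φ => v φ

/-- Instances of classical propositional tautologies. -/
def IsTautology (φ : Formula N Θ) : Prop := ∀ v : Formula N Θ → Prop, propEval v φ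

/-- The set of subformulas of a formula, itself included. -/
def subformulas : Formula N Θ → Set (Formula N Θ)
  | atom p => {atom p}
  | neg φ => insert (neg φ) (subformulas φ)
  | conj φ ψ => insert (conj φ ψ) (subformulas φ ∪ subformulas ψ)
  | coal G φ => insert (coal G φ) (subformulas φ)
  | know i φ => insert (know i φ) (subformulas φ)
  | common G hG φ => insert (common G hG φ) (subformulas φ)

end Formula

open Formula

/-- The Hilbert system `CLC`: `Provable φ` means `⊢ φ`. The coalition of all agents is
`Finset.univ`. -/
inductive Provable {N : Type u} {Θ : Type v} [Fintype N] [DecidableEq N] [Nonempty Θ] :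
    Formula N Θ → Prop
  | prop (φ : Formula N Θ) : IsTautology φ → Provable φ
  | G1 (G : Finset N) : Provable (neg (coal G bot))
  | G2 (G : Finset N) : Provable (coal G top)
  | G3 (φ : Formula N Θ) : Provable (imp (neg (coal ∅ (neg φ))) (coal Finset.univ φ))
  | G4 (G : Finset N) (φ ψ : Formula N Θ) : Provable (imp (coal G (conj φ ψ)) (coal G ψ))
  | G5 (G₁ G₂ : Finset N) (φ ψ : Formula N Θ) : G₁ ∩ G₂ = ∅ →
      Provable (imp (conj (coal G₁ φ) (coal G₂ ψ)) (coal (G₁ ∪ G₂) (conj φ ψ)))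
  | MP (φ ψ : Formula N Θ) : Provable φ → Provable (imp φ ψ) → Provable ψ
  | RG (G : Finset N) (φ ψ : Formula N Θ) :
      Provable (iff φ ψ) → Provable (iff (coal G φ) (coal G ψ))
  | K (i : N) (φ ψ : Formula N Θ) :
      Provable (imp (know i (imp φ ψ)) (imp (know i φ) (know i ψ)))
  | T (i : N) (φ : Formula N Θ) : Provable (imp (know i φ) φ)
  | four (i : N) (φ : Formula N Θ) : Provable (imp (know i φ) (know i (know i φ)))
  | five (i : N) (φ : Formula N Θ) :
      Provable (imp (neg (know i φ)) (know i (neg (know i φ))))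
  | C1 (G : Finset N) (φ : Formula N Θ) :
      Provable (iff (everyone G φ) (bigAnd (G.toList.map fun i => know i φ)))
  | C2 (G : Finset N) (hG : G.Nonempty) (φ : Formula N Θ) :
      Provable (imp (common G hG φ) (everyone G (conj φ (common G hG φ))))
  | RN (i : N) (φ : Formula N Θ) : Provable φ → Provable (know i φ)
  | RC (G : Finset N) (hG : G.Nonempty) (φ ψ : Formula N Θ) :
      Provable (imp φ (everyone G (conj φ ψ))) → Provable (imp φ (common G hG ψ))

/-- An effectivity function over agents `N` and states `S`. -/
abbrev Effectivity (N : Type u) (S : Type w) := Finset N → Set (Set S)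

section Effectivity

variable {N : Type u} {S : Type w} [Fintype N] [DecidableEq N]

/-- Playability, conditions E1-E5. -/
structure Effectivity.IsPlayable (E : Effectivity N S) : Prop where
  /-- E1 -/
  liveness : ∀ G, (∅ : Set S) ∉ E G
  /-- E2 -/
  safety : ∀ G, (Set.univ : Set S) ∈ E G
  /-- E3 -/
  maximality : ∀ X : Set S, Xᶜ ∉ E ∅ → X ∈ E Finset.univ
  /-- E4 -/
  monotonicity : ∀ G (X Y : Set S), X ⊆ Y → X ∈ E G → Y ∈ E G
  /-- E5 -/
  superadditivity : ∀ (G₁ G₂ : Finset N) (X Y : Set S), G₁ ∩ G₂ = ∅ →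
    X ∈ E G₁ → Y ∈ E G₂ → X ∩ Y ∈ E (G₁ ∪ G₂)

/-- The non-monotonic core of the empty coalition. -/
def Effectivity.core (E : Effectivity N S) : Set (Set S) :=
  {X | X ∈ E ∅ ∧ ¬ ∃ Y, Y ∈ E ∅ ∧ Y ⊂ X}

/-- True playability, conditions E1-E6. -/
structure Effectivity.IsTrulyPlayable (E : Effectivity N S) : Prop extends
    Effectivity.IsPlayable E where
  /-- E6 -/
  core_nonempty : (Effectivity.core E).Nonempty

end Effectivity

/-- A tuple `(S, E, (∼_i)_i, V)` of the shape of an epistemic coalition model; the conditions on it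
are imposed by `IsModel` or `IsPlayableModel`. -/
structure Structure (N : Type u) (Θ : Type v) where
  /-- states -/
  S : Type w
  /-- effectivity functions -/
  E : S → Effectivity N S
  /-- accessibility relations -/
  rel : N → S → S → Prop
  /-- valuation -/
  V : S → Set Θ

namespace Structure

variable {N : Type u} {Θ : Type v}

/-- Epistemic coalition models. -/
structure IsModel [Fintype N] [DecidableEq N] (M : Structure.{u, v, w} N Θ) : Prop where
  nonempty : Nonempty M.S
  equivalence : ∀ i, Equivalence (M.rel i)
  trulyPlayable : ∀ s, (M.E s).IsTrulyPlayable

/-- Playable models: only E1-E5 are required of the effectivity functions. -/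
structure IsPlayableModel [Fintype N] [DecidableEq N] (M : Structure.{u, v, w} N Θ) : Prop where
  nonempty : Nonempty M.S
  equivalence : ∀ i, Equivalence (M.rel i)
  playable : ∀ s, (M.E s).IsPlayable

/-- Truth of a formula at a state, `M, s ⊨ φ`. -/
def Sat (M : Structure.{u, v, w} N Θ) : M.S → Formula N Θ → Prop
  | s, atom p => p ∈ M.V s
  | s, neg φ => ¬ M.Sat s φ
  | s, conj φ ψ => M.Sat s φ ∧ M.Sat s ψ
  | s, coal G φ => {t | M.Sat t φ} ∈ M.E s G
  | s, know i φ => ∀ t, M.rel i s t → M.Sat t φ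
  | s, common G _ φ => ∀ t, Relation.TransGen (fun x y => ∃ i ∈ G, M.rel i x y) s t → M.Sat t φ

end Structure

section Canonical

variable {N : Type u} {Θ : Type v} [Fintype N] [DecidableEq N] [Nonempty Θ]

/-- A formula is consistent if its negation is not provable. -/
def IsConsistent (φ : Formula N Θ) : Prop := ¬ Provable (neg φ)

/-- A set of formulas is consistent if every finite conjunction of its members is. -/
def SetConsistent (Γ : Set (Formula N Θ)) : Prop :=
  ∀ l : List (Formula N Θ), (∀ ψ ∈ l, ψ ∈ Γ) → IsConsistent (bigAnd l)

variable (N Θ) in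
/-- States of the canonical model: the maximal consistent sets of formulas. -/
def CanonState : Type (max u v) := {s : Set (Formula N Θ) // Maximal SetConsistent s}

/-- The canonical states that contain `φ`. -/
def canonTruthSet (φ : Formula N Θ) : Set (CanonState N Θ) := {s | φ ∈ s.1}

variable (N Θ) in
/-- The canonical playable model `M^c`. -/
def canonicalModel : Structure.{u, v, max u v} N Θ where
  S := CanonState N Θ
  E s G := {X |
    if G = Finset.univ then
      ∀ φ : Formula N Θ, canonTruthSet φ ⊆ Xᶜ → coal ∅ φ ∉ s.1
    else
      ∃ φ : Formula N Θ, canonTruthSet φ ⊆ X ∧ coal G φ ∈ s.1}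
  rel i s t := {ψ | know i ψ ∈ s.1} = {ψ | know i ψ ∈ t.1}
  V s := {p | atom p ∈ s.1}

end Canonical

section Closure

variable {N : Type u} {Θ : Type v}

/-- Membership in `cl(φ)`: the least set that contains the subformulas of `φ` and is closed under
single negations and under passing from `C_G ψ` to `K_i C_G ψ` for `i ∈ G`. -/
inductive InClosure (φ : Formula N Θ) : Formula N Θ → Prop
  | sub (ψ : Formula N Θ) : ψ ∈ subformulas φ → InClosure φ ψ
  | single_neg (ψ : Formula N Θ) : InClosure φ ψ → (∀ χ, ψ ≠ neg χ) → InClosure φ (neg ψ)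
  | know_common (i : N) (G : Finset N) (hG : G.Nonempty) (ψ : Formula N Θ) : i ∈ G →
      InClosure φ (common G hG ψ) → InClosure φ (know i (common G hG ψ))

/-- The closure `cl(φ)`. -/
def cl (φ : Formula N Θ) : Set (Formula N Θ) := {ψ | InClosure φ ψ}

theorem subformulas_finite (φ : Formula N Θ) : (subformulas φ).Finite := by
  induction φ with
  | atom p => exact Set.finite_singleton _
  | neg φ ih => exact ih.insert _
  | conj φ ψ ih₁ ih₂ => exact (ih₁.union ih₂).insert _
  | coal G φ ih => exact ih.insert _
  | know i φ ih => exact ih.insert _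
  | common G hG φ ih => exact ih.insert _

theorem cl_finite [Finite N] (φ : Formula N Θ) : (cl φ).Finite := by
  let B : Set (Formula N Θ) :=
    subformulas φ ∪ (fun q : N × Formula N Θ => know q.1 q.2) '' (Set.univ ×ˢ subformulas φ)
  have hB : B.Finite :=
    (subformulas_finite φ).union ((Set.finite_univ.prod (subformulas_finite φ)).image _)
  refine (hB.union (hB.image neg)).subset ?_
  intro ψ hψ
  induction hψ with
  | sub ψ h => exact Or.inl (Or.inl h)
  | single_neg ψ _ hn ih =>
    rcases ih with h | ⟨χ, _, rfl⟩
    · exact Or.inr ⟨ψ, h, rfl⟩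
    · exact absurd rfl (hn χ)
  | know_common i G hG ψ _ _ ih =>
    rcases ih with (h | ⟨q, _, hq⟩) | ⟨χ, _, hχ⟩
    · exact Or.inl (Or.inr ⟨(i, common G hG ψ), ⟨trivial, h⟩, rfl⟩)
    · cases hq
    · cases hχ

end Closure

section Filtration

variable {N : Type u} {Θ : Type v} [Fintype N] [DecidableEq N] [Nonempty Θ]

/-- States of the filtration: the sets `[s] = s ∩ cl(φ)`, for `s` a canonical state. -/
def FiltState (φ : Formula N Θ) : Type (max u v) :=
  {x : Set (Formula N Θ) // ∃ s : CanonState N Θ, s.1 ∩ cl φ = x}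

/-- The map `s ↦ [s]`. -/
def filtClass (φ : Formula N Θ) (s : CanonState N Θ) : FiltState φ := ⟨s.1 ∩ cl φ, s, rfl⟩

theorem FiltState.finite_val {φ : Formula N Θ} (x : FiltState φ) : x.1.Finite := by
  obtain ⟨s, hs⟩ := x.2
  rw [← hs]
  exact (cl_finite φ).subset Set.inter_subset_right

instance FiltState.instFinite (φ : Formula N Θ) : Finite (FiltState φ) :=
  ((cl_finite φ).finite_subsets.subset (by
    rintro x ⟨s, rfl⟩
    exact Set.inter_subset_right) :
      {x : Set (Formula N Θ) | ∃ s : CanonState N Θ, s.1 ∩ cl φ = x}.Finite).to_subtype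

/-- `φ_[t]`: the conjunction of all formulas in `[t]`. -/
noncomputable def stateFormula {φ : Formula N Θ} (x : FiltState φ) : Formula N Θ :=
  bigAnd x.finite_val.toFinset.toList

/-- `φ_X`: the disjunction of the `φ_[t]` for `[t] ∈ X`. -/
noncomputable def setFormula {φ : Formula N Θ} (X : Set (FiltState φ)) : Formula N Θ :=
  bigOr (X.toFinite.toFinset.toList.map stateFormula)

/-- The filtration `M^f` of the canonical model through `cl(φ)`. The map `r` picks, for each state
`[s]`, the representative `s` at which `E^c` is evaluated to define `E^f` at `[s]`. -/
noncomputable def filtration (φ : Formula N Θ) (r : FiltState φ → CanonState N Θ) :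
    Structure.{u, v, max u v} N Θ where
  S := FiltState φ
  E x G := {X | canonTruthSet (setFormula X) ∈ (canonicalModel N Θ).E (r x) G}
  rel i x y := {ψ | know i ψ ∈ x.1} = {ψ | know i ψ ∈ y.1}
  V x := {p | ∃ s : CanonState N Θ, p ∈ (canonicalModel N Θ).V s ∧ filtClass φ s = x}

end Filtration

end CLC

/-! The states are maximal consistent sets, which by Lindenbaum's lemma separate unprovable
formulas, so provability reduces to membership in every state. The axioms G1–G5 and the replacement
rule say that the sets defined by formulas behave playably, and
`canonTruthSet_mem_canonEffectivity_iff` shows that on such sets the canonical effectivity is just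
membership of `coal G φ`, for every coalition.

In the filtration every set `X` of classes is definable, by `setFormula X`. So E1–E5 hold there
directly by the axioms, whether or not `N` is empty, and E6 holds because a finite nonempty family
of sets has a minimal member.

The truth lemma `filtration_sat_iff` is an induction over `cl φ`. Canonical accessibility implies
filtered accessibility, which settles `know`. For `common`, the set of reachable classes is
definable, and its formula is the invariant fed to the induction rule `RC` (`common_mem_of_closed`);
conversely, `C_G ψ` travels along the filtered relations because `K_i C_G ψ` lies in the closure. -/

namespace CLC

open Formula

/-! ### Evaluation of the propositional connectives -/

section Propositional

variable {N : Type u} {Θ : Type v}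

theorem Formula.propEval_neg (v : Formula N Θ → Prop) (φ : Formula N Θ) :
    propEval v (neg φ) ↔ ¬ propEval v φ := Iff.rfl

theorem Formula.propEval_conj (v : Formula N Θ → Prop) (φ ψ : Formula N Θ) :
    propEval v (conj φ ψ) ↔ propEval v φ ∧ propEval v ψ := Iff.rfl

theorem Formula.propEval_imp (v : Formula N Θ → Prop) (φ ψ : Formula N Θ) :
    propEval v (imp φ ψ) ↔ (propEval v φ → propEval v ψ) := by
  simp [imp, propEval]

theorem Formula.propEval_bot [Nonempty Θ] (v : Formula N Θ → Prop) :
    ¬ propEval v (bot : Formula N Θ) := by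
  simp [bot, propEval]

theorem Formula.propEval_top [Nonempty Θ] (v : Formula N Θ → Prop) :
    propEval v (top : Formula N Θ) := propEval_bot v

theorem Formula.propEval_bigAnd [Nonempty Θ] (v : Formula N Θ → Prop) (l : List (Formula N Θ)) :
    propEval v (bigAnd l) ↔ ∀ ψ ∈ l, propEval v ψ := by
  induction l with
  | nil => simpa [bigAnd] using propEval_top v
  | cons a l ih =>
    rw [List.forall_mem_cons, ← ih]
    exact Iff.rfl

end Propositional

/-! ### Derivability, Lindenbaum's lemma and maximal consistent sets -/

section Derivability

variable {N : Type u} {Θ : Type v} [Fintype N] [DecidableEq N] [Nonempty Θ]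

theorem Provable.of_propEval {a b : Formula N Θ} (ha : Provable a)
    (h : ∀ v, propEval v a → propEval v b) : Provable b :=
  .MP _ _ ha (.prop _ fun v => (propEval_imp v a b).2 (h v))

theorem Provable.of_propEval₂ {a b c : Formula N Θ} (ha : Provable a) (hb : Provable b)
    (h : ∀ v, propEval v a → propEval v b → propEval v c) : Provable c :=
  .MP _ _ hb (ha.of_propEval fun v hv => (propEval_imp v b c).2 (h v hv))

/-- `φ` follows from finitely many members of `Γ`. -/
def Derives (Γ : Set (Formula N Θ)) (φ : Formula N Θ) : Prop :=
  ∃ l : List (Formula N Θ), (∀ ψ ∈ l, ψ ∈ Γ) ∧ Provable (imp (bigAnd l) φ)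

theorem Derives.of_mem {Γ : Set (Formula N Θ)} {φ : Formula N Θ} (h : φ ∈ Γ) : Derives Γ φ :=
  ⟨[φ], by simpa using h, .prop _ fun v => by simp [propEval_imp, propEval_bigAnd]⟩

theorem Derives.of_provable {Γ : Set (Formula N Θ)} {φ : Formula N Θ} (h : Provable φ) :
    Derives Γ φ :=
  ⟨[], by simp, h.of_propEval fun v hv => (propEval_imp _ _ _).2 fun _ => hv⟩

theorem Derives.of_propEval₂ {Γ : Set (Formula N Θ)} {a b c : Formula N Θ} (ha : Derives Γ a)
    (hb : Derives Γ b) (h : ∀ v, propEval v a → propEval v b → propEval v c) : Derives Γ c := by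
  obtain ⟨l, hl, pl⟩ := ha
  obtain ⟨m, hm, pm⟩ := hb
  refine ⟨l ++ m, fun ψ hψ => (List.mem_append.1 hψ).elim (hl ψ) (hm ψ),
    pl.of_propEval₂ pm fun v h₁ h₂ => ?_⟩
  rw [propEval_imp, propEval_bigAnd] at *
  exact fun h₃ => h v (h₁ fun ψ hψ => h₃ ψ (List.mem_append_left _ hψ))
    (h₂ fun ψ hψ => h₃ ψ (List.mem_append_right _ hψ))

theorem SetConsistent.not_derives_neg {Γ : Set (Formula N Θ)} (hΓ : SetConsistent Γ)
    {φ : Formula N Θ} (h : Derives Γ φ) : ¬ Derives Γ (neg φ) := by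
  intro h'
  obtain ⟨l, hl, pl⟩ := h.of_propEval₂ h' (c := bot) fun v h₁ h₂ => (h₂ h₁).elim
  refine hΓ l hl (pl.of_propEval fun v hv hb => ?_)
  exact propEval_bot v ((propEval_imp _ _ _).1 hv hb)

/-- Deleting `φ` from a refutable list leaves members of `Γ`, and these already refute `φ`. -/
theorem derives_neg_of_not_setConsistent_insert {Γ : Set (Formula N Θ)} {φ : Formula N Θ}
    (h : ¬ SetConsistent (insert φ Γ)) : Derives Γ (neg φ) := by
  classical
  simp only [SetConsistent, IsConsistent, not_forall, not_not] at h
  obtain ⟨l, hl, pl⟩ := h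
  refine ⟨l.filter (· ≠ φ), fun ψ hψ => ?_, pl.of_propEval fun v hv => ?_⟩
  · simp only [List.mem_filter, decide_eq_true_eq] at hψ
    exact (hl ψ hψ.1).resolve_left hψ.2
  · simp only [propEval_imp, propEval_neg, propEval_bigAnd] at *
    refine fun h₁ h₂ => hv fun ψ hψ => ?_
    by_cases e : ψ = φ
    · exact e ▸ h₂
    · exact h₁ ψ (by simp [hψ, e])

theorem setConsistent_singleton_neg {φ : Formula N Θ} (h : ¬ Provable φ) :
    SetConsistent ({neg φ} : Set (Formula N Θ)) := by
  by_contra hc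
  rw [← insert_empty_eq] at hc
  obtain ⟨l, hl, pl⟩ := derives_neg_of_not_setConsistent_insert hc
  refine h (pl.of_propEval fun v hv => not_not.1 ((propEval_imp _ _ _).1 hv ?_))
  exact (propEval_bigAnd _ _).2 fun ψ hψ => (hl ψ hψ).elim

theorem IsConsistent.setConsistent_singleton {φ : Formula N Θ} (h : IsConsistent φ) :
    SetConsistent ({φ} : Set (Formula N Θ)) := fun l hl pl =>
  h (pl.of_propEval fun v hv hφ => hv ((propEval_bigAnd _ _).2 fun ψ hψ => by
    rw [Set.mem_singleton_iff.1 (hl ψ hψ)]; exact hφ))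

/-- Lindenbaum's lemma. -/
theorem SetConsistent.exists_canonState {Γ : Set (Formula N Θ)} (h : SetConsistent Γ) :
    ∃ s : CanonState N Θ, Γ ⊆ s.1 := by
  obtain ⟨m, hm, hmax⟩ := zorn_subset_nonempty {Δ : Set (Formula N Θ) | SetConsistent Δ} (by
    intro c hc hchain hne
    refine ⟨⋃₀ c, fun l hl => ?_, fun _ => Set.subset_sUnion_of_mem⟩
    -- Consistency is finitary: a finite list from the union of a chain lies in one member.
    have : ∃ Δ ∈ c, ∀ ψ ∈ l, ψ ∈ Δ := by
      induction l with
      | nil => exact hne.imp fun Δ hΔ => ⟨hΔ, by simp⟩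
      | cons a l ih =>
        obtain ⟨Δ, hΔ, hl'⟩ := ih fun ψ hψ => hl ψ (List.mem_cons_of_mem _ hψ)
        obtain ⟨Δ', hΔ', ha⟩ := hl a List.mem_cons_self
        rcases hchain.total hΔ hΔ' with hs | hs
        · exact ⟨Δ', hΔ', List.forall_mem_cons.2 ⟨ha, fun ψ hψ => hs (hl' ψ hψ)⟩⟩
        · exact ⟨Δ, hΔ, List.forall_mem_cons.2 ⟨hs ha, hl'⟩⟩
    obtain ⟨Δ, hΔ, hl'⟩ := this
    exact hc hΔ l hl') Γ h
  exact ⟨⟨m, hmax⟩, hm⟩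

namespace CanonState

variable (s : CanonState N Θ) {φ ψ : Formula N Θ}

theorem mem_of_derives (h : Derives s.1 φ) : φ ∈ s.1 := by
  by_contra hn
  refine s.2.prop.not_derives_neg h (derives_neg_of_not_setConsistent_insert fun hc => hn ?_)
  exact s.2.le_of_ge hc (Set.subset_insert _ _) (Set.mem_insert _ _)

theorem mem_of_provable (h : Provable φ) : φ ∈ s.1 := s.mem_of_derives (.of_provable h)

theorem neg_mem_iff : neg φ ∈ s.1 ↔ φ ∉ s.1 := by
  refine ⟨fun h h' => s.2.prop.not_derives_neg (.of_mem h') (.of_mem h), fun h => ?_⟩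
  refine s.mem_of_derives (derives_neg_of_not_setConsistent_insert fun hc => h ?_)
  exact s.2.le_of_ge hc (Set.subset_insert _ _) (Set.mem_insert _ _)

theorem conj_mem_iff : conj φ ψ ∈ s.1 ↔ φ ∈ s.1 ∧ ψ ∈ s.1 := by
  refine ⟨fun h => ⟨?_, ?_⟩, fun h => s.mem_of_derives
    (Derives.of_propEval₂ (.of_mem h.1) (.of_mem h.2) fun v h₁ h₂ => ⟨h₁, h₂⟩)⟩
  · exact s.mem_of_derives (Derives.of_propEval₂ (.of_mem h) (.of_mem h) fun v h₁ _ => h₁.1)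
  · exact s.mem_of_derives (Derives.of_propEval₂ (.of_mem h) (.of_mem h) fun v h₁ _ => h₁.2)

theorem imp_mem_iff : imp φ ψ ∈ s.1 ↔ (φ ∈ s.1 → ψ ∈ s.1) := by
  simp [imp, neg_mem_iff, conj_mem_iff]

theorem disj_mem_iff : disj φ ψ ∈ s.1 ↔ (φ ∈ s.1 ∨ ψ ∈ s.1) := by
  simp only [disj, neg_mem_iff, conj_mem_iff]
  tauto

theorem iff_mem_iff : iff φ ψ ∈ s.1 ↔ (φ ∈ s.1 ↔ ψ ∈ s.1) := by
  simp only [Formula.iff, imp_mem_iff, conj_mem_iff]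
  tauto

theorem bot_notMem : bot ∉ s.1 := by
  simp [bot, neg_mem_iff, conj_mem_iff]

theorem top_mem : top ∈ s.1 := s.neg_mem_iff.2 s.bot_notMem

theorem bigAnd_mem_iff (l : List (Formula N Θ)) : bigAnd l ∈ s.1 ↔ ∀ ψ ∈ l, ψ ∈ s.1 := by
  induction l with
  | nil => simpa [bigAnd] using s.top_mem
  | cons a l ih =>
    rw [List.forall_mem_cons, ← ih]
    exact s.conj_mem_iff

theorem bigOr_mem_iff (l : List (Formula N Θ)) : bigOr l ∈ s.1 ↔ ∃ ψ ∈ l, ψ ∈ s.1 := by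
  induction l with
  | nil => simpa [bigOr] using s.bot_notMem
  | cons a l ih =>
    rw [List.exists_mem_cons_iff, ← ih]
    exact s.disj_mem_iff

theorem everyone_mem_iff (G : Finset N) : everyone G φ ∈ s.1 ↔ ∀ i ∈ G, know i φ ∈ s.1 := by
  simp [everyone, bigAnd_mem_iff]

theorem mem_of_mem_of_provable (h : φ ∈ s.1) (hp : Provable (imp φ ψ)) : ψ ∈ s.1 :=
  s.imp_mem_iff.1 (s.mem_of_provable hp) h

end CanonState

/-- Turns set-theoretic facts about canonical states into theorems of the system, to which its rules
then apply. -/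
theorem provable_of_forall_mem {φ : Formula N Θ} (h : ∀ s : CanonState N Θ, φ ∈ s.1) :
    Provable φ := by
  by_contra hn
  obtain ⟨s, hs⟩ := (setConsistent_singleton_neg hn).exists_canonState
  exact s.neg_mem_iff.1 (hs rfl) (h s)

theorem provable_imp_of_canonTruthSet_subset {φ ψ : Formula N Θ}
    (h : canonTruthSet φ ⊆ canonTruthSet ψ) : Provable (imp φ ψ) :=
  provable_of_forall_mem fun s => s.imp_mem_iff.2 fun hs => h hs

end Derivability

/-! ### Coalition and knowledge modalities in canonical states; playability of the canonical
structure -/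

section Canonical

variable {N : Type u} {Θ : Type v} [Fintype N] [DecidableEq N] [Nonempty Θ]

namespace CanonState

variable (s : CanonState N Θ) {φ ψ : Formula N Θ}

/-- The inclusion makes `φ` provably equivalent to `φ ∧ ψ`; replacement followed by G4 does the
rest. -/
theorem coal_mono (G : Finset N) (h : canonTruthSet φ ⊆ canonTruthSet ψ)
    (hφ : coal G φ ∈ s.1) : coal G ψ ∈ s.1 := by
  have h₁ : Provable (iff φ (conj φ ψ)) := provable_of_forall_mem fun t => by
    rw [iff_mem_iff, conj_mem_iff]
    exact ⟨fun ht => ⟨ht, h ht⟩, And.left⟩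
  have h₂ := (s.iff_mem_iff.1 (s.mem_of_provable (.RG G _ _ h₁))).1 hφ
  exact s.mem_of_mem_of_provable h₂ (.G4 G φ ψ)

theorem coal_union {G₁ G₂ : Finset N} (hG : G₁ ∩ G₂ = ∅) (h₁ : coal G₁ φ ∈ s.1)
    (h₂ : coal G₂ ψ ∈ s.1) : coal (G₁ ∪ G₂) (conj φ ψ) ∈ s.1 :=
  s.mem_of_mem_of_provable (s.conj_mem_iff.2 ⟨h₁, h₂⟩) (.G5 _ _ _ _ hG)

theorem coal_notMem_of_empty (G : Finset N) (h : canonTruthSet φ = ∅) : coal G φ ∉ s.1 := by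
  intro hφ
  refine s.neg_mem_iff.1 (s.mem_of_provable (.G1 G)) (s.coal_mono G ?_ hφ)
  rw [h]
  exact Set.empty_subset _

theorem coal_mem_of_univ (G : Finset N) (h : canonTruthSet φ = Set.univ) : coal G φ ∈ s.1 := by
  refine s.coal_mono G ?_ (s.mem_of_provable (.G2 G))
  rw [h]
  exact Set.subset_univ _

/-- One direction is G3. For the other, G5 would combine the two into `[N](φ ∧ ¬φ)`, against G1. -/
theorem coal_univ_mem_iff : coal Finset.univ φ ∈ s.1 ↔ coal ∅ (neg φ) ∉ s.1 := by
  refine ⟨fun h h' => ?_, fun h => s.mem_of_mem_of_provable (s.neg_mem_iff.2 h) (.G3 φ)⟩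
  refine s.coal_notMem_of_empty _ ?_ (s.coal_union (Finset.inter_empty _) h h')
  ext t
  simp [canonTruthSet, conj_mem_iff, neg_mem_iff]

theorem know_mono (i : N) (hp : Provable (imp φ ψ)) (h : know i φ ∈ s.1) : know i ψ ∈ s.1 :=
  s.imp_mem_iff.1 (s.mem_of_mem_of_provable (s.mem_of_provable (.RN i _ hp)) (.K i φ ψ)) h

theorem know_conj (i : N) (h₁ : know i φ ∈ s.1) (h₂ : know i ψ ∈ s.1) :
    know i (conj φ ψ) ∈ s.1 := by
  have hp : Provable (imp φ (imp ψ (conj φ ψ))) :=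
    .prop _ fun v => by simp only [propEval_imp, propEval_conj]; tauto
  exact s.imp_mem_iff.1 (s.mem_of_mem_of_provable (s.know_mono i hp h₁) (.K i _ _)) h₂

theorem know_bigAnd (i : N) (l : List (Formula N Θ)) (h : ∀ ψ ∈ l, know i ψ ∈ s.1) :
    know i (bigAnd l) ∈ s.1 := by
  induction l with
  | nil => exact s.mem_of_provable (.RN i _ (.prop _ propEval_top))
  | cons a l ih =>
    rw [List.forall_mem_cons] at h
    exact s.know_conj i h.1 (ih h.2)

theorem mem_of_know_mem {i : N} (h : know i φ ∈ s.1) : φ ∈ s.1 :=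
  s.mem_of_mem_of_provable h (.T i φ)

/-- The truth lemma for `K_i` in the canonical structure, in its non-trivial direction. -/
theorem know_mem_of_forall (i : N)
    (h : ∀ t : CanonState N Θ, (canonicalModel N Θ).rel i s t → φ ∈ t.1) : know i φ ∈ s.1 := by
  by_contra hn
  -- Otherwise finitely many formulas known at `s` imply `φ`, and `K_i` distributes over this
  -- derivation.
  have hc : SetConsistent (insert (neg φ) {ψ | know i ψ ∈ s.1}) := by
    by_contra hc
    obtain ⟨l, hl, pl⟩ := derives_neg_of_not_setConsistent_insert hc
    refine hn (s.know_mono i ?_ (s.know_bigAnd i l hl))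
    exact pl.of_propEval fun v => by simp only [propEval_imp, propEval_neg]; tauto
  obtain ⟨t, ht⟩ := hc.exists_canonState
  refine t.neg_mem_iff.1 (ht (Set.mem_insert _ _))
    (h t (Set.ext fun ψ => ⟨fun hψ => ?_, fun hψ => ?_⟩))
  -- Positive and negative introspection put `K_i ψ` or its negation among the formulas known at
  -- `s`, hence in `t`.
  · exact ht (Set.mem_insert_of_mem _ (s.mem_of_mem_of_provable hψ (.four i ψ)))
  · by_contra hψ'
    refine t.neg_mem_iff.1 (ht (Set.mem_insert_of_mem _ ?_)) hψ
    exact s.mem_of_mem_of_provable (s.neg_mem_iff.2 hψ') (.five i ψ)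

end CanonState

/-- The effectivity functions of the canonical structure. -/
def canonEffectivity (s : CanonState N Θ) : Effectivity N (CanonState N Θ) := fun G => {X |
    if G = Finset.univ then
      ∀ φ : Formula N Θ, canonTruthSet φ ⊆ Xᶜ → coal ∅ φ ∉ s.1
    else
      ∃ φ : Formula N Θ, canonTruthSet φ ⊆ X ∧ coal G φ ∈ s.1}

theorem mem_canonEffectivity_univ {s : CanonState N Θ} {X : Set (CanonState N Θ)} :
    X ∈ canonEffectivity s Finset.univ ↔
      ∀ φ : Formula N Θ, canonTruthSet φ ⊆ Xᶜ → coal ∅ φ ∉ s.1 := by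
  simp [canonEffectivity]

theorem mem_canonEffectivity_of_ne {s : CanonState N Θ} {G : Finset N} (hG : G ≠ Finset.univ)
    {X : Set (CanonState N Θ)} :
    X ∈ canonEffectivity s G ↔
      ∃ φ : Formula N Θ, canonTruthSet φ ⊆ X ∧ coal G φ ∈ s.1 := by
  simp [canonEffectivity, hG]

theorem canonTruthSet_neg (φ : Formula N Θ) : canonTruthSet (neg φ) = (canonTruthSet φ)ᶜ :=
  Set.ext fun s => s.neg_mem_iff

theorem canonTruthSet_conj (φ ψ : Formula N Θ) :
    canonTruthSet (conj φ ψ) = canonTruthSet φ ∩ canonTruthSet ψ :=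
  Set.ext fun s => s.conj_mem_iff

/-- On definable sets the two clauses of the definition agree: monotonicity handles the existential
one, and duality between `N` and `∅` the universal one. -/
theorem canonTruthSet_mem_canonEffectivity_iff (s : CanonState N Θ) (G : Finset N)
    (φ : Formula N Θ) :
    canonTruthSet φ ∈ canonEffectivity s G ↔ coal G φ ∈ s.1 := by
  by_cases hG : G = Finset.univ
  · subst hG
    rw [mem_canonEffectivity_univ, s.coal_univ_mem_iff, ← canonTruthSet_neg]
    exact ⟨fun h => h _ subset_rfl, fun h ψ hψ hc => h (s.coal_mono ∅ hψ hc)⟩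
  · rw [mem_canonEffectivity_of_ne hG]
    exact ⟨fun ⟨ψ, hψ, hc⟩ => s.coal_mono G hψ hc, fun h => ⟨φ, subset_rfl, h⟩⟩

theorem canonEffectivity_isPlayable [Nonempty N] (s : CanonState N Θ) :
    (canonEffectivity s).IsPlayable := by
  -- Here `N` must be nonempty, so that the empty coalition falls under the existential clause.
  have hne : (∅ : Finset N) ≠ Finset.univ := Finset.univ_nonempty.ne_empty.symm
  have htop : canonTruthSet (top : Formula N Θ) = Set.univ :=
    Set.eq_univ_of_forall fun t => t.top_mem
  have hbot : canonTruthSet (bot : Formula N Θ) = ∅ :=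
    Set.eq_empty_of_forall_notMem fun t => t.bot_notMem
  have hmono : ∀ G (X Y : Set (CanonState N Θ)), X ⊆ Y →
      X ∈ canonEffectivity s G → Y ∈ canonEffectivity s G := by
    intro G X Y hXY hX
    by_cases hG : G = Finset.univ
    · subst hG
      rw [mem_canonEffectivity_univ] at *
      exact fun φ hφ => hX φ (hφ.trans (Set.compl_subset_compl.2 hXY))
    · rw [mem_canonEffectivity_of_ne hG] at *
      exact hX.imp fun φ hφ => ⟨hφ.1.trans hXY, hφ.2⟩
  have huniv : ∀ X Y : Set (CanonState N Θ), X ∈ canonEffectivity s Finset.univ →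
      Y ∈ canonEffectivity s ∅ → X ∩ Y ∈ canonEffectivity s Finset.univ := by
    intro X Y hX hY
    rw [mem_canonEffectivity_univ] at *
    rw [mem_canonEffectivity_of_ne hne] at hY
    obtain ⟨ψ, hψ, hψs⟩ := hY
    intro χ hχ hχs
    -- If `χ` avoids `X ∩ Y` and `ψ` stays inside `Y`, then `ψ ∧ χ` avoids `X`.
    refine hX (conj ψ χ) ?_ (by simpa using s.coal_union (Finset.inter_empty _) hψs hχs)
    rw [canonTruthSet_conj]
    exact fun t ht hX => hχ ht.2 ⟨hX, hψ ht.1⟩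
  refine ⟨fun G h => ?_, fun G => ?_, fun X hX => ?_, hmono, fun G₁ G₂ X Y hG hX hY => ?_⟩
  · rw [← hbot] at h
    exact s.coal_notMem_of_empty G hbot ((canonTruthSet_mem_canonEffectivity_iff s G _).1 h)
  · rw [← htop]
    exact (canonTruthSet_mem_canonEffectivity_iff s G _).2 (s.coal_mem_of_univ G htop)
  · rw [mem_canonEffectivity_of_ne hne] at hX
    rw [mem_canonEffectivity_univ]
    exact fun φ hφ hs => hX ⟨φ, hφ, hs⟩
  · by_cases h₁ : G₁ = Finset.univ
    · subst h₁
      rw [Finset.univ_inter] at hG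
      subst hG
      simpa using huniv X Y hX hY
    by_cases h₂ : G₂ = Finset.univ
    · subst h₂
      rw [Finset.inter_univ] at hG
      subst hG
      simpa [Set.inter_comm] using huniv Y X hY hX
    obtain ⟨φ, hφ, hφs⟩ := (mem_canonEffectivity_of_ne h₁).1 hX
    obtain ⟨ψ, hψ, hψs⟩ := (mem_canonEffectivity_of_ne h₂).1 hY
    -- The union may be all of `N`; shrinking to a definable set avoids distinguishing the clauses.
    refine hmono _ _ _ (Set.inter_subset_inter hφ hψ) ?_
    rw [← canonTruthSet_conj, canonTruthSet_mem_canonEffectivity_iff]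
    exact s.coal_union hG hφs hψs

end Canonical

/-! ### True playability over finite state sets -/

section Effectivity

variable {N : Type u} [Fintype N] [DecidableEq N]

theorem Effectivity.IsPlayable.isTrulyPlayable {S : Type w} [Finite S] {E : Effectivity N S}
    (h : E.IsPlayable) : E.IsTrulyPlayable := by
  obtain ⟨X, hX⟩ := Set.Finite.exists_minimal (Set.toFinite (E ∅)) ⟨_, h.safety ∅⟩
  exact ⟨h, X, hX.prop, fun ⟨Y, hY, hlt⟩ => hX.not_lt hY hlt⟩

end Effectivity

/-! ### The closure, the filtration and its truth lemma -/

section Filtration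

variable {N : Type u} {Θ : Type v}

theorem Formula.mem_subformulas_self (φ : Formula N Θ) : φ ∈ subformulas φ := by
  cases φ <;> simp [subformulas]

theorem Formula.subformulas_subset {φ ψ : Formula N Θ} (h : ψ ∈ subformulas φ) :
    subformulas ψ ⊆ subformulas φ := by
  induction φ with
  | atom p =>
    rw [Set.mem_singleton_iff.1 h]
  | neg φ ih | coal G φ ih | know i φ ih | common G hG φ ih =>
    rcases h with rfl | h
    · exact subset_rfl
    · exact (ih h).trans (Set.subset_insert _ _)
  | conj φ χ ih₁ ih₂ =>
    rcases h with rfl | h | h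
    · exact subset_rfl
    · exact (ih₁ h).trans (Set.subset_union_left.trans (Set.subset_insert _ _))
    · exact (ih₂ h).trans (Set.subset_union_right.trans (Set.subset_insert _ _))

theorem self_mem_cl (φ : Formula N Θ) : φ ∈ cl φ := .sub _ φ.mem_subformulas_self

theorem mem_cl_of_mem_subformulas {φ ψ χ : Formula N Θ} (h : ψ ∈ cl φ)
    (hχ : χ ∈ subformulas ψ) : χ ∈ cl φ := by
  induction h with
  | sub ψ h => exact .sub _ (subformulas_subset h hχ)
  | single_neg ψ h hn ih =>
    rcases hχ with rfl | hχ
    · exact .single_neg _ h hn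
    · exact ih hχ
  | know_common i G hG ψ hi h ih =>
    rcases hχ with rfl | hχ
    · exact .know_common _ _ _ _ hi h
    · exact ih hχ

variable [Fintype N] [DecidableEq N] [Nonempty Θ] {φ : Formula N Θ}

/-- Containing `[t]` already forces `[s] = [t]`: if `ψ` in the closure is missing from `t`, then `t`
contains its single negation, or its negand when `ψ` is itself a negation, and both lie in the
closure. -/
theorem stateFormula_mem_iff (s : CanonState N Θ) (x : FiltState φ) :
    stateFormula x ∈ s.1 ↔ filtClass φ s = x := by
  rw [stateFormula, s.bigAnd_mem_iff]
  simp only [Finset.mem_toList, Set.Finite.mem_toFinset]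
  obtain ⟨_, t, rfl⟩ := x
  refine ⟨fun h => Subtype.ext ?_, fun h ψ hψ => ((congrArg Subtype.val h).ge hψ).1⟩
  refine Set.Subset.antisymm (fun ψ hψ => ⟨?_, hψ.2⟩) fun ψ hψ => ⟨h ψ hψ, hψ.2⟩
  by_contra hn
  by_cases hneg : ∃ χ, ψ = neg χ
  · obtain ⟨χ, rfl⟩ := hneg
    rw [t.neg_mem_iff, not_not] at hn
    refine s.neg_mem_iff.1 hψ.1 (h χ ⟨hn, mem_cl_of_mem_subformulas hψ.2 ?_⟩)
    exact Set.mem_insert_of_mem _ χ.mem_subformulas_self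
  · exact s.neg_mem_iff.1
      (h (neg ψ) ⟨t.neg_mem_iff.2 hn, .single_neg ψ hψ.2 (not_exists.1 hneg)⟩) hψ.1

theorem setFormula_mem_iff (s : CanonState N Θ) (X : Set (FiltState φ)) :
    setFormula X ∈ s.1 ↔ filtClass φ s ∈ X := by
  rw [setFormula, s.bigOr_mem_iff]
  simp [stateFormula_mem_iff]

theorem canonTruthSet_setFormula (X : Set (FiltState φ)) :
    canonTruthSet (setFormula X) = filtClass φ ⁻¹' X :=
  Set.ext fun s => setFormula_mem_iff s X

variable (r : FiltState φ → CanonState N Θ)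

/-- The effectivity functions of the filtration. -/
def filtEffectivity (x : FiltState φ) : Effectivity N (FiltState φ) :=
  fun G => {X | canonTruthSet (setFormula X) ∈ canonEffectivity (r x) G}

theorem mem_filtEffectivity_iff (x : FiltState φ) (G : Finset N) (X : Set (FiltState φ)) :
    X ∈ filtEffectivity r x G ↔ coal G (setFormula X) ∈ (r x).1 :=
  canonTruthSet_mem_canonEffectivity_iff _ _ _

/-- Set operations on classes match connectives on their defining formulas, so each condition is its
axiom read at `r x`. Nothing requires `r x` to represent `x`. -/
theorem filtEffectivity_isPlayable (x : FiltState φ) : (filtEffectivity r x).IsPlayable := by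
  refine ⟨fun G h => ?_, fun G => ?_, fun X hX => ?_, fun G X Y hXY hX => ?_,
    fun G₁ G₂ X Y hG hX hY => ?_⟩
  · exact (r x).coal_notMem_of_empty G (canonTruthSet_setFormula _)
      ((mem_filtEffectivity_iff r x G _).1 h)
  · exact (mem_filtEffectivity_iff r x G _).2
      ((r x).coal_mem_of_univ G (canonTruthSet_setFormula _))
  · refine (mem_filtEffectivity_iff r x _ _).2 ((r x).coal_univ_mem_iff.2 fun h => hX ?_)
    refine (mem_filtEffectivity_iff r x _ _).2 ((r x).coal_mono _ ?_ h)
    rw [canonTruthSet_neg, canonTruthSet_setFormula, canonTruthSet_setFormula]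
    exact subset_rfl
  · refine (mem_filtEffectivity_iff r x _ _).2 ((r x).coal_mono _ ?_
      ((mem_filtEffectivity_iff r x _ _).1 hX))
    rw [canonTruthSet_setFormula, canonTruthSet_setFormula]
    exact Set.preimage_mono hXY
  · refine (mem_filtEffectivity_iff r x _ _).2 ((r x).coal_mono _ ?_
      ((r x).coal_union hG ((mem_filtEffectivity_iff r x _ _).1 hX)
        ((mem_filtEffectivity_iff r x _ _).1 hY)))
    rw [canonTruthSet_conj]
    simp only [canonTruthSet_setFormula]
    exact subset_rfl

theorem filtration_rel_equivalence (i : N) : Equivalence ((filtration φ r).rel i) :=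
  ⟨fun _ => rfl, Eq.symm, Eq.trans⟩

variable {r}

theorem mem_iff_mem_representative (hr : ∀ x, filtClass φ (r x) = x) {ψ : Formula N Θ}
    (hψ : ψ ∈ cl φ) (x : FiltState φ) : ψ ∈ x.1 ↔ ψ ∈ (r x).1 := by
  conv_lhs => rw [← hr x]
  exact and_iff_left hψ

/-- The step for common knowledge: a set of classes that is closed under the relations of `G` and
on which `ψ` holds makes `C_G ψ` true. -/
theorem common_mem_of_closed {G : Finset N} (hG : G.Nonempty) {ψ : Formula N Θ}
    {X : Set (FiltState φ)}
    (hX : ∀ x ∈ X, ∀ i ∈ G, ∀ y, (filtration φ r).rel i x y → y ∈ X)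
    (hψ : ∀ s : CanonState N Θ, filtClass φ s ∈ X → ψ ∈ s.1)
    {s : CanonState N Θ} (hs : filtClass φ s ∈ X) : common G hG ψ ∈ s.1 := by
  refine s.mem_of_mem_of_provable ((setFormula_mem_iff s X).2 hs)
    (.RC G hG _ _ (provable_of_forall_mem fun t => ?_))
  rw [t.imp_mem_iff, setFormula_mem_iff, t.everyone_mem_iff]
  refine fun ht i hi => t.know_mem_of_forall i fun t' h => ?_
  -- Canonically related states have related classes, as equality of known formulas survives
  -- intersection with `cl φ`.
  have ht' : filtClass φ t' ∈ X := hX _ ht i hi _ (Set.ext fun χ =>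
    and_congr_left' (Set.ext_iff.1 h χ))
  exact t'.conj_mem_iff.2 ⟨(setFormula_mem_iff t' X).2 ht', hψ t' ht'⟩

/-- The truth lemma for the filtration. -/
theorem filtration_sat_iff (hr : ∀ x, filtClass φ (r x) = x) {ψ : Formula N Θ}
    (hψ : ψ ∈ cl φ) (x : FiltState φ) : (filtration φ r).Sat x ψ ↔ ψ ∈ x.1 := by
  induction ψ generalizing x with
  | atom p =>
    refine ⟨?_, fun h => ⟨r x, (mem_iff_mem_representative hr hψ x).1 h, hr x⟩⟩
    rintro ⟨s, hs, rfl⟩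
    exact ⟨hs, hψ⟩
  | neg ψ ih =>
    have hψ' : ψ ∈ cl φ := mem_cl_of_mem_subformulas hψ
      (Set.mem_insert_of_mem _ ψ.mem_subformulas_self)
    change ¬ _ ↔ _
    rw [ih hψ', mem_iff_mem_representative hr hψ,
      mem_iff_mem_representative hr hψ', (r x).neg_mem_iff]
  | conj ψ χ ih₁ ih₂ =>
    have h₁ : ψ ∈ cl φ := mem_cl_of_mem_subformulas hψ
      (Set.mem_insert_of_mem _ (Or.inl ψ.mem_subformulas_self))
    have h₂ : χ ∈ cl φ := mem_cl_of_mem_subformulas hψ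
      (Set.mem_insert_of_mem _ (Or.inr χ.mem_subformulas_self))
    change _ ∧ _ ↔ _
    rw [ih₁ h₁, ih₂ h₂, mem_iff_mem_representative hr hψ,
      mem_iff_mem_representative hr h₁, mem_iff_mem_representative hr h₂, (r x).conj_mem_iff]
  | coal G ψ ih =>
    have hψ' : ψ ∈ cl φ := mem_cl_of_mem_subformulas hψ
      (Set.mem_insert_of_mem _ ψ.mem_subformulas_self)
    have hset : {t : FiltState φ | (filtration φ r).Sat t ψ} = {t | ψ ∈ t.1} :=
      Set.ext fun t => ih hψ' t
    -- The formula defining the classes that contain `ψ` is equivalent to `ψ` itself.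
    have htruth : canonTruthSet (setFormula {t : FiltState φ | ψ ∈ t.1}) = canonTruthSet ψ := by
      rw [canonTruthSet_setFormula]
      exact Set.ext fun s => and_iff_left hψ'
    have hE : (filtration φ r).Sat x (coal G ψ) ↔
        {t : FiltState φ | ψ ∈ t.1} ∈ filtEffectivity r x G := by
      rw [← hset]
      exact Iff.rfl
    rw [hE, mem_iff_mem_representative hr hψ, ← canonTruthSet_mem_canonEffectivity_iff, ← htruth]
    exact Iff.rfl
  | know i ψ ih =>
    have hψ' : ψ ∈ cl φ := mem_cl_of_mem_subformulas hψ
      (Set.mem_insert_of_mem _ ψ.mem_subformulas_self)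
    refine ⟨fun h => ?_, fun h y hxy => ?_⟩
    · rw [mem_iff_mem_representative hr hψ]
      refine (r x).know_mem_of_forall i fun t ht => ?_
      refine ((ih hψ' (filtClass φ t)).1 (h _ ?_)).1
      conv_lhs => rw [← hr x]
      exact Set.ext fun χ => and_congr_left' (Set.ext_iff.1 ht χ)
    · have hy : know i ψ ∈ y.1 := (Set.ext_iff.1 hxy ψ).1 h
      refine (ih hψ' y).2 ((mem_iff_mem_representative hr hψ' y).2 ?_)
      exact (r y).mem_of_know_mem ((mem_iff_mem_representative hr hψ y).1 hy)
  | common G hG ψ ih =>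
    have hψ' : ψ ∈ cl φ := mem_cl_of_mem_subformulas hψ
      (Set.mem_insert_of_mem _ ψ.mem_subformulas_self)
    refine ⟨fun h => ?_, fun h => ?_⟩
    · rw [mem_iff_mem_representative hr hψ]
      refine common_mem_of_closed (r := r) hG
        (X := {y | Relation.TransGen (fun x y => ∃ i ∈ G, (filtration φ r).rel i x y) x y})
        (fun y hy i hi z hz => hy.tail ⟨i, hi, hz⟩)
        (fun s hs => ((ih hψ' _).1 (h _ hs)).1) ?_
      rw [hr x]
      -- The transitive closure reaches `x` itself through a reflexive step of some agent in the
      -- nonempty `G`.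
      exact .single (hG.imp fun i hi => ⟨hi, rfl⟩)
    · have hfix : ∀ y : FiltState φ, common G hG ψ ∈ y.1 →
          ∀ i ∈ G, know i (conj ψ (common G hG ψ)) ∈ (r y).1 := fun y hy =>
        ((r y).everyone_mem_iff G).1 ((r y).mem_of_mem_of_provable
          ((mem_iff_mem_representative hr hψ y).1 hy) (.C2 G hG ψ))
      have hstep : ∀ y z : FiltState φ, common G hG ψ ∈ y.1 →
          (∃ i ∈ G, (filtration φ r).rel i y z) → common G hG ψ ∈ z.1 := by
        rintro y z hy ⟨i, hi, hyz⟩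
        -- Filtered accessibility only transfers knowledge formulas in the closure, hence its clause
        -- for `K_i C_G ψ`.
        have hk : know i (common G hG ψ) ∈ cl φ := .know_common i G hG ψ hi hψ
        have hky : know i (common G hG ψ) ∈ y.1 := by
          rw [mem_iff_mem_representative hr hk]
          exact (r y).know_mono i (provable_imp_of_canonTruthSet_subset fun t ht =>
            (t.conj_mem_iff.1 ht).2) (hfix y hy i hi)
        have hkz : know i (common G hG ψ) ∈ z.1 := (Set.ext_iff.1 hyz _).1 hky
        rw [mem_iff_mem_representative hr hψ]
        exact (r z).mem_of_know_mem ((mem_iff_mem_representative hr hk z).1 hkz)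
      intro y hxy
      have hy : common G hG ψ ∈ y.1 := by
        induction hxy with
        | single hz => exact hstep _ _ h hz
        | tail _ hz ihz => exact hstep _ _ ihz hz
      obtain ⟨i, hi⟩ := hG
      refine (ih hψ' y).2 ((mem_iff_mem_representative hr hψ' y).2 ?_)
      exact ((r y).conj_mem_iff.1 ((r y).mem_of_know_mem (hfix y hy i hi))).1

end Filtration

end CLC

theorem mainTheorem2 {N : Type u} {Θ : Type v} [Fintype N] [DecidableEq N] [Nonempty Θ]
    (φ : CLC.Formula N Θ) (hφ : CLC.IsConsistent φ) :
    (∃ M : CLC.Structure.{u, v, max u v} N Θ, M.IsModel ∧ ∃ s : M.S, M.Sat s φ) ∧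
    (Nonempty N → (CLC.canonicalModel N Θ).IsPlayableModel) ∧
    (∀ r : CLC.FiltState φ → CLC.CanonState N Θ, (∀ x, CLC.filtClass φ (r x) = x) →
      Finite (CLC.filtration φ r).S ∧
      (CLC.filtration φ r).IsPlayableModel ∧
      (CLC.filtration φ r).IsModel ∧
      ∃ x : (CLC.filtration φ r).S, (CLC.filtration φ r).Sat x φ) := by
  obtain ⟨s, hs⟩ := hφ.setConsistent_singleton.exists_canonState
  have hfilt : ∀ r : CLC.FiltState φ → CLC.CanonState N Θ, (∀ x, CLC.filtClass φ (r x) = x) →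
      (CLC.filtration φ r).IsModel ∧
      ∃ x : (CLC.filtration φ r).S, (CLC.filtration φ r).Sat x φ := fun r hr =>
    ⟨⟨⟨CLC.filtClass φ s⟩, CLC.filtration_rel_equivalence r,
      fun x => (CLC.filtEffectivity_isPlayable r x).isTrulyPlayable (S := CLC.FiltState φ)⟩,
      CLC.filtClass φ s, (CLC.filtration_sat_iff hr (CLC.self_mem_cl φ) _).2
        ⟨hs rfl, CLC.self_mem_cl φ⟩⟩
  refine ⟨?_, fun _ => ⟨⟨s⟩, fun i => ⟨fun _ => rfl, Eq.symm, Eq.trans⟩,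
    CLC.canonEffectivity_isPlayable⟩, fun r hr => ⟨CLC.FiltState.instFinite φ, ?_, hfilt r hr⟩⟩
  · choose r hr using fun x : CLC.FiltState φ => x.2
    exact ⟨_, hfilt r fun x => Subtype.ext (hr x)⟩
  · obtain ⟨h, _⟩ := hfilt r hr
    exact ⟨h.nonempty, h.equivalence, fun x => (h.trulyPlayable x).toIsPlayable⟩
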